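/- Let $\mathcal H=L_2(0,1)$ be the complex Hilbert space of square-integrable functions on $(0,1)$ and $\mathcal B(\mathcal H)$ the algebra of bounded linear operators on $\mathcal H$. Let $S\in\mathcal B(\mathcal H)$ be given by $(Sf)(x)=xf(x)$, write $[A,B]=AB-BA$, and denote by $\operatorname{spr}(A)$ the spectral radius of $A$. Let $\mathcal H_+=\{f\in\mathcal H : f(x)\ge 0 \text{ for a.e. } x\in(0,1)\}$, write $f\le g$ if $g-f\in\mathcal H_+$, and let $|f|\in\mathcal H_+$ be the function $|f|(x)=|f(x)|$. An operator $A\in\mathcal B(\mathcal H)$ is called nonnegative if $A\mathcal H_+\subset\mathcal H_+$. For $A,B\in\mathcal B(\mathcal H)$, we say that $B$ majorises $A$ if $|Af|\le B|f|$ for all $f\in\mathcal H$. Let $\mathcal B_{\mathcal M}(\mathcal H)$ be the set of all $A\in\mathcal B(\mathcal H)$ that are majorised by some nonnegative operator in $\mathcal B(\mathcal H)$. For $a\in[0,1]$ let $\chi_a$ be the operator of multiplication by the characteristic function of $[a,1]$, let $$\mathcal A=\{A\in\mathcal B(\mathcal H) : A\chi_a=\chi_aA\chi_a \text{ for all } a\in[0,1]\},$$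 and let $\mathcal A_+$ be the set of nonnegative operators in $\mathcal A$. **Corollary 3.4.** Let $V\in\mathcal A$, and suppose that there is an operator $W\in\mathcal A_+$ with $\operatorname{spr}(W)<1/2$ such that $[S,W]$ majorises $V$. Then the equation $$[S,K]+VK+V=0$$ has a solution $K\in\mathcal B_{\mathcal M}(\mathcal H)\cap\mathcal A$ with $\operatorname{spr}(K)<1$. -/

import Mathlib

open MeasureTheory
open scoped ENNReal

noncomputable section

namespace L2Volterra

/-- Lebesgue measure on the interval `(0,1)`. -/
abbrev mu : Measure ℝ := (volume : Measure ℝ).restrict (Set.Ioo 0 1)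

/-- The complex Hilbert space `L₂(0,1)`. -/
abbrev H : Type := Lp ℂ 2 mu

/-- The algebra of bounded linear operators on `L₂(0,1)`. -/
abbrev Op : Type := H →L[ℂ] H

theorem memLp_mul {φ : ℝ → ℂ} (hφ : Measurable φ)
    (hb : ∀ x ∈ Set.Ioo (0 : ℝ) 1, ‖φ x‖ ≤ 1) (f : H) :
    MemLp (fun x => φ x * f x) 2 mu := by
  refine (Lp.memLp f).of_le (hφ.aestronglyMeasurable.mul (Lp.aestronglyMeasurable f)) ?_
  filter_upwards [ae_restrict_mem measurableSet_Ioo] with x hx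
  rw [norm_mul]
  exact mul_le_of_le_one_left (norm_nonneg _) (hb x hx)

/-- Multiplication by a measurable function `φ` with `|φ| ≤ 1` on `(0,1)`, as a bounded operator
on `L₂(0,1)`. -/
def mulOp (φ : ℝ → ℂ) (hφ : Measurable φ)
    (hb : ∀ x ∈ Set.Ioo (0 : ℝ) 1, ‖φ x‖ ≤ 1) : Op :=
  LinearMap.mkContinuous
    { toFun := fun f => (memLp_mul hφ hb f).toLp
      map_add' := fun f g => by
        rw [← MemLp.toLp_add]
        refine MemLp.toLp_congr _ _ ?_
        filter_upwards [Lp.coeFn_add f g] with x hx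
        simp only [hx, Pi.add_apply, mul_add]
      map_smul' := fun c f => by
        rw [RingHom.id_apply, ← MemLp.toLp_const_smul]
        refine MemLp.toLp_congr _ _ ?_
        filter_upwards [Lp.coeFn_smul c f] with x hx
        simp only [hx, Pi.smul_apply, smul_eq_mul]
        ring }
    1 (fun f => by
      rw [one_mul]
      refine Lp.norm_le_norm_of_ae_le ?_
      filter_upwards [ae_restrict_mem measurableSet_Ioo,
        (memLp_mul hφ hb f).coeFn_toLp] with x hx h
      change ‖((memLp_mul hφ hb f).toLp) x‖ ≤ _
      rw [h, norm_mul]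
      exact mul_le_of_le_one_left (norm_nonneg _) (hb x hx))

theorem mulOp_apply {φ : ℝ → ℂ} (hφ : Measurable φ)
    (hb : ∀ x ∈ Set.Ioo (0 : ℝ) 1, ‖φ x‖ ≤ 1) (f : H) :
    mulOp φ hφ hb f =ᵐ[mu] fun x => φ x * f x :=
  (memLp_mul hφ hb f).coeFn_toLp

/-- The operator `S` of multiplication by the independent variable, `(S f)(x) = x f(x)`. -/
def S : Op :=
  mulOp (fun x => (x : ℂ)) Complex.measurable_ofReal (fun x hx => by
    rw [Complex.norm_real, Real.norm_eq_abs, abs_of_pos hx.1]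
    exact hx.2.le)

/-- The operator of multiplication by the characteristic function of `[a,1]`. -/
def chi (a : ℝ) : Op :=
  mulOp ((Set.Icc a 1).indicator fun _ => (1 : ℂ))
    (measurable_const.indicator measurableSet_Icc) (fun x _ => by
      refine (norm_indicator_le_norm_self _ x).trans ?_
      simp)

/-- The cone of nonnegative elements: `f` is real and `f ≥ 0` almost everywhere in `(0,1)`. -/
def posCone : Set H := {f | ∀ᵐ x ∂mu, 0 ≤ (f x).re ∧ (f x).im = 0}

/-- The absolute value `|f|` of an element of `L₂(0,1)`, `|f|(x) = |f(x)|`. -/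
def absH (f : H) : H := ((Lp.memLp f).norm.ofReal (K := ℂ)).toLp

/-- The cone of nonnegative operators: those that map nonnegative elements to nonnegative
elements. -/
def posOps : Set Op := {A | ∀ f ∈ posCone, A f ∈ posCone}

/-- `B` majorises `A`: `|A f| ≤ B |f|` for every `f`, the order being that of the cone. -/
def Majorises (B A : Op) : Prop := ∀ f : H, B (absH f) - absH (A f) ∈ posCone

/-- The set of nonnegative operators that majorise `A`. -/
def majorants (A : Op) : Set Op := {B | B ∈ posOps ∧ Majorises B A}

/-- The operators that are majorised by some nonnegative operator. -/
def majorisedOps : Set Op := {A | (majorants A).Nonempty}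

/-- The operators that, for every `a`, leave invariant the functions supported in `[a,1]`. -/
def volterraAlg : Set Op :=
  {A | ∀ a ∈ Set.Icc (0 : ℝ) 1, A * chi a = chi a * A * chi a}

/-- The nonnegative elements of `volterraAlg`. -/
def volterraPos : Set Op := volterraAlg ∩ posOps

/-- The commutator `[A,B] = AB - BA`. -/
def comm (A B : Op) : Op := A * B - B * A

end L2Volterra

end

open MeasureTheory
open scoped ENNReal

noncomputable section

namespace L2Volterra

open Filter Topology

/-! The core is the linear equation `[S,K] = A` when `[S,B]` majorises `A` and `B ≥ 0`
(`exists_comm_eq`). The flow `conjS t A = e^{-tS} A e^{tS}` has derivative `-[S, conjS t A]`, so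
formally `K = ∫₀^∞ conjS t A dt`. For `t ≥ 0` the flow preserves majorisation, so the truncated
integrals are controlled by differences of the decreasing positive family `conjS t B`. This gives
strong convergence and the majorant `B`.

Then put `k₀ = 1` and solve `[S, k_{n+1}] = -V k_n`, with `k_n` majorised by `W^n`; this works
because `[S, W^{n+1}] ≥ [S,W] W^n`. The sum `K = ∑_{n≥1} k_n` solves the equation and is majorised
by `M = W(1-W)⁻¹`. The map `w ↦ w/(1-w)` sends `|w| < 1/2` into the unit disc, so `spr(K) ≤ spr(M) <
1`. -/

/-! ### The positive cone and the modulus. -/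

theorem absH_ae (f : H) : absH f =ᵐ[mu] fun x => ((‖f x‖ : ℝ) : ℂ) :=
  MemLp.coeFn_toLp _

theorem norm_absH (f : H) : ‖absH f‖ = ‖f‖ := by
  have h : ∀ᵐ x ∂mu, ‖absH f x‖ = ‖f x‖ := by
    filter_upwards [absH_ae f] with x hx
    rw [hx, Complex.norm_real, norm_norm]
  exact le_antisymm (Lp.norm_le_norm_of_ae_le (h.mono fun x hx => hx.le))
    (Lp.norm_le_norm_of_ae_le (h.mono fun x hx => hx.ge))

theorem norm_absH_sub_absH_le (f g : H) : ‖absH f - absH g‖ ≤ ‖f - g‖ := by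
  refine Lp.norm_le_norm_of_ae_le ?_
  filter_upwards [absH_ae f, absH_ae g, Lp.coeFn_sub f g, Lp.coeFn_sub (absH f) (absH g)]
    with x h1 h2 h3 h4
  rw [h4, h3, Pi.sub_apply, Pi.sub_apply, h1, h2, ← Complex.ofReal_sub, Complex.norm_real]
  exact abs_norm_sub_norm_le _ _

theorem continuous_absH : Continuous absH :=
  (LipschitzWith.of_dist_le_mul (K := 1) fun f g => by
    rw [dist_eq_norm, dist_eq_norm, NNReal.coe_one, one_mul]
    exact norm_absH_sub_absH_le f g).continuous

theorem mem_posCone_iff_absH_eq (f : H) : f ∈ posCone ↔ absH f = f := by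
  constructor
  · intro h
    refine Lp.ext ?_
    filter_upwards [absH_ae f, h] with x hx hp
    rw [hx]
    have : f x = ((f x).re : ℂ) := Complex.ext rfl (by simp [hp.2])
    rw [this, Complex.norm_real, Real.norm_eq_abs, abs_of_nonneg hp.1]
  · intro h
    change ∀ᵐ x ∂mu, _
    filter_upwards [absH_ae f] with x hx
    rw [h] at hx
    rw [hx]
    simp

theorem isClosed_posCone : IsClosed posCone := by
  have : posCone = {f | absH f = f} := Set.ext mem_posCone_iff_absH_eq
  rw [this]
  exact isClosed_eq continuous_absH continuous_id

theorem absH_mem_posCone (f : H) : absH f ∈ posCone := by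
  change ∀ᵐ x ∂mu, _
  filter_upwards [absH_ae f] with x hx
  rw [hx]
  simp

theorem zero_mem_posCone : (0 : H) ∈ posCone := by
  change ∀ᵐ x ∂mu, _
  filter_upwards [Lp.coeFn_zero ℂ 2 mu] with x hx
  rw [hx]
  simp

theorem add_mem_posCone {f g : H} (hf : f ∈ posCone) (hg : g ∈ posCone) : f + g ∈ posCone := by
  change ∀ᵐ x ∂mu, _
  filter_upwards [Lp.coeFn_add f g, hf, hg] with x hx h1 h2
  rw [hx, Pi.add_apply, Complex.add_re, Complex.add_im, h1.2, h2.2]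
  exact ⟨add_nonneg h1.1 h2.1, add_zero _⟩

theorem smul_mem_posCone {f : H} (hf : f ∈ posCone) {c : ℝ} (hc : 0 ≤ c) :
    c • f ∈ posCone := by
  change ∀ᵐ x ∂mu, _
  filter_upwards [Lp.coeFn_smul c f, hf] with x hx h1
  rw [hx, Pi.smul_apply, Complex.smul_re, Complex.smul_im, h1.2]
  exact ⟨mul_nonneg hc h1.1, smul_zero _⟩

theorem absH_zero : absH 0 = 0 := (mem_posCone_iff_absH_eq 0).1 zero_mem_posCone

theorem absH_add_le (f g : H) : absH f + absH g - absH (f + g) ∈ posCone := by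
  change ∀ᵐ x ∂mu, _
  filter_upwards [absH_ae f, absH_ae g, absH_ae (f + g), Lp.coeFn_add f g,
    Lp.coeFn_add (absH f) (absH g), Lp.coeFn_sub (absH f + absH g) (absH (f + g))]
    with x h1 h2 h3 h4 h5 h6
  rw [h6, Pi.sub_apply, h5, Pi.add_apply, h1, h2, h3, h4, Pi.add_apply, ← Complex.ofReal_add,
    ← Complex.ofReal_sub, Complex.ofReal_re, Complex.ofReal_im]
  exact ⟨sub_nonneg.2 (norm_add_le _ _), rfl⟩

theorem absH_smul (c : ℝ) (f : H) : absH (c • f) = |c| • absH f := by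
  refine Lp.ext ?_
  filter_upwards [absH_ae f, absH_ae (c • f), Lp.coeFn_smul c f, Lp.coeFn_smul |c| (absH f)]
    with x h1 h2 h3 h4
  rw [h2, h3, h4, Pi.smul_apply, Pi.smul_apply, h1, norm_smul, Real.norm_eq_abs]
  simp

/-- The inner product of two nonnegative functions is nonnegative. -/
theorem re_inner_nonneg {f g : H} (hf : f ∈ posCone) (hg : g ∈ posCone) :
    0 ≤ (inner ℂ f g).re := by
  rw [L2.inner_def, ← RCLike.re_eq_complex_re, ← integral_re (L2.integrable_inner f g)]
  refine integral_nonneg_of_ae ?_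
  filter_upwards [hf, hg] with x h1 h2
  simp only [Pi.zero_apply, RCLike.inner_apply, RCLike.re_eq_complex_re, Complex.mul_re,
    Complex.conj_re, Complex.conj_im, h1.2, h2.2]
  simpa using mul_nonneg h2.1 h1.1

/-- Expand `‖(g - f) + f‖²`; the cross term is nonnegative. This turns monotonicity into norm
convergence. -/
theorem norm_sub_sq_le {f g : H} (hf : f ∈ posCone) (hg : g - f ∈ posCone) :
    ‖g - f‖ ^ 2 ≤ ‖g‖ ^ 2 - ‖f‖ ^ 2 := by
  have h := norm_add_sq (𝕜 := ℂ) (g - f) f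
  rw [sub_add_cancel] at h
  have h2 := re_inner_nonneg hg hf
  rw [RCLike.re_eq_complex_re] at h
  linarith

theorem norm_le_of_sub_mem {f g : H} (hf : f ∈ posCone) (hg : g - f ∈ posCone) : ‖f‖ ≤ ‖g‖ := by
  have h := norm_sub_sq_le hf hg
  have h2 := sq_nonneg ‖g - f‖
  exact le_of_sq_le_sq (by linarith) (norm_nonneg _)

/-! ### Calculus of majorisation. -/

theorem mem_majorants_zero {B : Op} : B ∈ majorants 0 ↔ B ∈ posOps := by
  refine ⟨fun h => h.1, fun h => ⟨h, fun f => ?_⟩⟩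
  rw [zero_apply, absH_zero, sub_zero]
  exact h _ (absH_mem_posCone f)

theorem Majorises.mem_posOps {B A : Op} (h : Majorises B A) : B ∈ posOps := by
  intro f hf
  have := add_mem_posCone (h f) (absH_mem_posCone (A f))
  rwa [sub_add_cancel, (mem_posCone_iff_absH_eq f).1 hf] at this

theorem Majorises.mem_majorants {B A : Op} (h : Majorises B A) : B ∈ majorants A :=
  ⟨h.mem_posOps, h⟩

theorem Majorises.add {B A B' A' : Op} (h : Majorises B A) (h' : Majorises B' A') :
    Majorises (B + B') (A + A') := by
  intro f
  have := add_mem_posCone (add_mem_posCone (h f) (h' f)) (absH_add_le (A f) (A' f))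
  convert this using 1
  simp only [add_apply]
  abel

theorem Majorises.smul {B A : Op} (h : Majorises B A) {c : ℝ} (hc : 0 ≤ c) :
    Majorises (c • B) (c • A) := by
  intro f
  have := smul_mem_posCone (h f) hc
  rwa [smul_sub, ← abs_of_nonneg hc, ← absH_smul, abs_of_nonneg hc] at this

theorem Majorises.mul {B A B' A' : Op} (h : Majorises B A) (h' : Majorises B' A') :
    Majorises (B * B') (A * A') := by
  intro f
  have := add_mem_posCone (h.mem_posOps _ (h' f)) (h (A' f))
  rwa [map_sub, sub_add_sub_cancel] at this

theorem majorises_one : Majorises 1 1 := fun f => by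
  simpa using zero_mem_posCone

theorem majorises_zero : Majorises 0 0 := fun f => by
  simpa [absH_zero] using zero_mem_posCone

theorem Majorises.pow {B A : Op} (h : Majorises B A) (n : ℕ) : Majorises (B ^ n) (A ^ n) := by
  induction n with
  | zero => simpa using majorises_one
  | succ n ih => rw [pow_succ, pow_succ]; exact ih.mul h

theorem majorises_zero_iff {B : Op} : Majorises B 0 ↔ B ∈ posOps :=
  ⟨fun h => h.mem_posOps, fun h => (mem_majorants_zero.2 h).2⟩

theorem Majorises.neg {B A : Op} (h : Majorises B A) : Majorises B (-A) := by
  intro f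
  have h1 : absH ((-A) f) = absH (A f) := by
    have := absH_smul (-1) (A f)
    simpa using this
  rw [h1]
  exact h f

theorem Majorises.mono {B B' A : Op} (h : Majorises B A) (hB : B' - B ∈ posOps) :
    Majorises B' A := by
  have := (majorises_zero_iff.2 hB).add h
  rwa [sub_add_cancel, zero_add] at this

theorem Majorises.norm_apply_le {B A : Op} (h : Majorises B A) (f : H) :
    ‖A f‖ ≤ ‖B (absH f)‖ := by
  rw [← norm_absH]
  exact norm_le_of_sub_mem (absH_mem_posCone _) (h f)

theorem Majorises.norm_le {B A : Op} (h : Majorises B A) : ‖A‖ ≤ ‖B‖ :=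
  A.opNorm_le_bound (norm_nonneg _) fun f =>
    (h.norm_apply_le f).trans ((B.le_opNorm _).trans (by rw [norm_absH]))

theorem majorises_of_tendsto {ι : Type*} {l : Filter ι} [l.NeBot] {b a : ι → Op} {B A : Op}
    (hb : ∀ f, Tendsto (fun i => b i f) l (𝓝 (B f))) (ha : ∀ f, Tendsto (fun i => a i f) l (𝓝 (A f)))
    (h : ∀ i, Majorises (b i) (a i)) : Majorises B A := fun f =>
  isClosed_posCone.mem_of_tendsto
    ((hb _).sub ((continuous_absH.tendsto _).comp (ha f))) (Eventually.of_forall fun i => h i f)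

/-- The pairs `(B, A)` such that `B` majorises `A`. -/
def majorPairs : Set (Op × Op) := {p | Majorises p.1 p.2}

theorem isClosed_majorPairs : IsClosed majorPairs := by
  have : majorPairs = ⋂ f : H, {p : Op × Op | p.1 (absH f) - absH (p.2 f) ∈ posCone} := by
    ext p
    simp [majorPairs, Majorises]
  rw [this]
  refine isClosed_iInter fun f => isClosed_posCone.preimage ?_
  refine Continuous.sub ?_ (continuous_absH.comp ?_)
  · exact (ContinuousLinearMap.apply ℂ H (absH f)).continuous.comp continuous_fst
  · exact (ContinuousLinearMap.apply ℂ H f).continuous.comp continuous_snd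

theorem convex_majorPairs : Convex ℝ majorPairs := fun _ hp _ hq _ _ ha hb _ =>
  (Majorises.smul hp ha).add (Majorises.smul hq hb)

/-- The average over the interval stays in the closed convex set; scaling by the length recovers the
integral. -/
theorem integral_mem_of_cone {E : Type*} [NormedAddCommGroup E] [NormedSpace ℝ E]
    [CompleteSpace E] {C : Set E} (hC : Convex ℝ C) (hcl : IsClosed C) (h0 : (0 : E) ∈ C)
    (hs : ∀ c : ℝ, 0 ≤ c → ∀ x ∈ C, c • x ∈ C) {φ : ℝ → E} (hφ : Continuous φ) {a b : ℝ}
    (hab : a ≤ b) (h : ∀ s ∈ Set.Icc a b, φ s ∈ C) : ∫ s in a..b, φ s ∈ C := by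
  rcases hab.eq_or_lt with rfl | hlt
  · simpa using h0
  have key := hC.set_average_mem (μ := volume) (t := Set.Ioc a b) (f := φ) hcl
    (by simpa using hlt) (by simp)
    ((ae_restrict_mem measurableSet_Ioc).mono fun s hs => h s ⟨hs.1.le, hs.2⟩)
    (hφ.integrableOn_Ioc)
  have := hs (b - a) (sub_nonneg.2 hab) _ key
  rw [setAverage_eq, smul_smul] at this
  rw [intervalIntegral.integral_of_le hab]
  convert this
  simp [max_eq_left (sub_nonneg.2 hab), mul_inv_cancel₀ (sub_pos.2 hlt).ne']

theorem majorises_integral {b a : ℝ → Op} (hb : Continuous b) (ha : Continuous a) {x y : ℝ}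
    (hxy : x ≤ y) (h : ∀ s ∈ Set.Icc x y, Majorises (b s) (a s)) :
    Majorises (∫ s in x..y, b s) (∫ s in x..y, a s) := by
  have := integral_mem_of_cone convex_majorPairs isClosed_majorPairs majorises_zero
    (fun c hc p hp => Majorises.smul hp hc) (hb.prodMk ha) hxy h
  rw [intervalIntegral.integral_of_le hxy, integral_pair hb.integrableOn_Ioc ha.integrableOn_Ioc]
    at this
  rw [intervalIntegral.integral_of_le hxy, intervalIntegral.integral_of_le hxy]
  exact this

theorem tendsto_apply {ι : Type*} {l : Filter ι} {a : ι → Op} {A : Op} (h : Tendsto a l (𝓝 A))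
    (f : H) : Tendsto (fun i => a i f) l (𝓝 (A f)) :=
  ((ContinuousLinearMap.apply ℂ H f).continuous.tendsto A).comp h

theorem majorises_sum {ι : Type*} {b a : ι → Op} (h : ∀ i, Majorises (b i) (a i)) (s : Finset ι) :
    Majorises (∑ i ∈ s, b i) (∑ i ∈ s, a i) := by
  induction s using Finset.cons_induction with
  | empty => exact majorises_zero
  | cons i s hi ih => rw [Finset.sum_cons, Finset.sum_cons]; exact (h i).add ih

theorem majorises_hasSum {ι : Type*} {b a : ι → Op} {B A : Op} (hb : HasSum b B) (ha : HasSum a A)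
    (h : ∀ i, Majorises (b i) (a i)) : Majorises B A :=
  majorises_of_tendsto (tendsto_apply hb) (tendsto_apply ha) (majorises_sum h)

theorem majorises_of_ae {B A : Op} (h : ∀ f : H, ∀ᵐ x ∂mu, B (absH f) x = ((‖A f x‖ : ℝ) : ℂ)) :
    Majorises B A := by
  intro f
  have : B (absH f) = absH (A f) := by
    refine Lp.ext ?_
    filter_upwards [h f, absH_ae (A f)] with x h1 h2
    rw [h1, h2]
  rw [this, sub_self]
  exact zero_mem_posCone

/-! ### Positivity of the exponentials of `S`. -/

theorem S_apply_ae (f : H) : S f =ᵐ[mu] fun x => (x : ℂ) * f x := mulOp_apply _ _ f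

theorem chi_apply_ae (a : ℝ) (f : H) :
    chi a f =ᵐ[mu] fun x => (Set.Icc a 1).indicator (fun _ => (1 : ℂ)) x * f x :=
  mulOp_apply _ _ f

theorem majorises_S : Majorises S S := by
  refine majorises_of_ae fun f => ?_
  filter_upwards [S_apply_ae f, S_apply_ae (absH f), absH_ae f, ae_restrict_mem measurableSet_Ioo]
    with x h1 h2 h3 hx
  rw [h1, h2, h3, norm_mul, Complex.norm_real, Real.norm_eq_abs, abs_of_pos hx.1,
    Complex.ofReal_mul]

theorem majorises_one_sub_S : Majorises (1 - S) (1 - S) := by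
  have key : ∀ f : H, ∀ᵐ x ∂mu, (1 - S) f x = ((1 - x : ℝ) : ℂ) * f x := fun f => by
    filter_upwards [S_apply_ae f, Lp.coeFn_sub f (S f)] with x h1 h2
    rw [sub_apply, one_apply_eq_self, h2, Pi.sub_apply, h1]
    push_cast
    ring
  refine majorises_of_ae fun f => ?_
  filter_upwards [key f, key (absH f), absH_ae f, ae_restrict_mem measurableSet_Ioo]
    with x h1 h2 h3 hx
  rw [h1, h2, h3, norm_mul, Complex.norm_real, Real.norm_eq_abs,
    abs_of_pos (sub_pos.2 hx.2), Complex.ofReal_mul]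

theorem hasSum_exp (Q : Op) :
    HasSum (fun n : ℕ => ((n.factorial : ℝ)⁻¹) • Q ^ n) (NormedSpace.exp Q) :=
  letI := NormedAlgebra.restrictScalars ℚ ℝ Op
  NormedSpace.exp_series_hasSum_exp' (𝕂 := ℝ) Q

theorem majorises_exp {Q : Op} (h : Majorises Q Q) :
    Majorises (NormedSpace.exp Q) (NormedSpace.exp Q) :=
  majorises_hasSum (hasSum_exp Q) (hasSum_exp Q) fun n => (h.pow n).smul (by positivity)

theorem exp_sub_one_mem_posOps {Q : Op} (h : Q ∈ posOps) : NormedSpace.exp Q - 1 ∈ posOps := by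
  have h1 := (hasSum_nat_add_iff' 1).2 (hasSum_exp Q)
  simp only [Finset.sum_range_one, Nat.factorial_zero, Nat.cast_one, inv_one, pow_zero,
    one_smul] at h1
  refine majorises_zero_iff.1 (majorises_hasSum h1 hasSum_zero fun n => majorises_zero_iff.2 ?_)
  refine (Majorises.smul (A := 0) (majorises_zero_iff.2 ?_) (by positivity)).mem_posOps
  have := (majorises_zero_iff.2 h).pow (n + 1)
  exact this.mem_posOps

theorem exp_add_of_commute {P Q : Op} (h : Commute P Q) :
    NormedSpace.exp (P + Q) = NormedSpace.exp P * NormedSpace.exp Q :=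
  letI := NormedAlgebra.restrictScalars ℚ ℝ Op
  NormedSpace.exp_add_of_commute h

/-- The operator of multiplication by `exp (t x)`. -/
def expS (t : ℝ) : Op := NormedSpace.exp (t • S)

theorem expS_zero : expS 0 = 1 := by simp [expS]

theorem expS_add (s t : ℝ) : expS (s + t) = expS s * expS t := by
  rw [expS, add_smul]
  exact exp_add_of_commute (((Commute.refl S).smul_left s).smul_right t)

theorem commute_expS {X : Op} (h : Commute X S) (t : ℝ) : Commute X (expS t) :=
  letI := NormedAlgebra.restrictScalars ℚ ℝ Op
  (h.smul_right t).exp_right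

theorem exp_smul_one (t : ℝ) : NormedSpace.exp (t • (1 : Op)) = Real.exp t • (1 : Op) := by
  have h := NormedSpace.algebraMap_exp_comm (𝕂 := ℝ) (𝔸 := Op) t
  rw [← Real.exp_eq_exp_ℝ, Algebra.algebraMap_eq_smul_one, Algebra.algebraMap_eq_smul_one] at h
  exact h.symm

/-- Since `1 - S ≥ 0`, this form makes `e^{-tS}` for `t ≥ 0` a power series with positive terms. -/
theorem expS_neg (t : ℝ) : expS (-t) = Real.exp (-t) • NormedSpace.exp (t • (1 - S)) := by
  have h : (-t) • S = (-t) • (1 : Op) + t • (1 - S) := by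
    rw [smul_sub, neg_smul, neg_smul]
    abel
  rw [expS, h, exp_add_of_commute ((Commute.one_left _).smul_left _), exp_smul_one,
    smul_mul_assoc, one_mul]

theorem majorises_expS {t : ℝ} (ht : 0 ≤ t) : Majorises (expS t) (expS t) :=
  majorises_exp (majorises_S.smul ht)

theorem majorises_expS_neg {t : ℝ} (ht : 0 ≤ t) : Majorises (expS (-t)) (expS (-t)) := by
  rw [expS_neg]
  exact (majorises_exp (majorises_one_sub_S.smul ht)).smul (Real.exp_nonneg _)

theorem expS_sub_one_mem_posOps {t : ℝ} (ht : 0 ≤ t) : expS t - 1 ∈ posOps :=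
  exp_sub_one_mem_posOps (majorises_S.smul ht).mem_posOps

theorem mul_mem_posOps {A B : Op} (hA : A ∈ posOps) (hB : B ∈ posOps) : A * B ∈ posOps :=
  fun f hf => hA _ (hB f hf)

theorem add_mem_posOps {A B : Op} (hA : A ∈ posOps) (hB : B ∈ posOps) : A + B ∈ posOps :=
  fun f hf => add_mem_posCone (hA f hf) (hB f hf)

theorem smul_mem_posOps {A : Op} (hA : A ∈ posOps) {c : ℝ} (hc : 0 ≤ c) : c • A ∈ posOps :=
  fun f hf => smul_mem_posCone (hA f hf) hc

theorem expS_neg_sub_mem_posOps {t : ℝ} (ht : 0 ≤ t) :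
    expS (-t) - Real.exp (-t) • (1 : Op) ∈ posOps := by
  rw [expS_neg, ← smul_sub]
  exact smul_mem_posOps
    (exp_sub_one_mem_posOps (majorises_one_sub_S.smul ht).mem_posOps) (Real.exp_nonneg _)

/-! ### The conjugation flow. -/

/-- Conjugation by `exp (t S)`. If `A` has kernel `k(x,y)`, then `conjS t A` has kernel
`exp (-t (x - y)) k(x,y)`. -/
def conjS (t : ℝ) (A : Op) : Op := expS (-t) * A * expS t

theorem conjS_zero (A : Op) : conjS 0 A = A := by simp [conjS, expS_zero]

theorem conjS_add (s t : ℝ) (A : Op) : conjS (s + t) A = conjS s (conjS t A) := by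
  rw [conjS, conjS, conjS, neg_add, expS_add, add_comm s t, expS_add]
  simp only [mul_assoc]

theorem comm_conjS (t : ℝ) (A : Op) : comm S (conjS t A) = conjS t (comm S A) := by
  have h1 : S * expS (-t) = expS (-t) * S := commute_expS (Commute.refl S) _
  have h2 : S * expS t = expS t * S := commute_expS (Commute.refl S) _
  simp only [comm, conjS, mul_sub, sub_mul]
  rw [mul_assoc (expS (-t) * A), ← h2, ← mul_assoc S, ← mul_assoc S, h1]
  simp only [mul_assoc]

theorem Majorises.conjS {B A : Op} (h : Majorises B A) {t : ℝ} (ht : 0 ≤ t) :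
    Majorises (conjS t B) (conjS t A) :=
  ((majorises_expS_neg ht).mul h).mul (majorises_expS ht)

/-- Combines `e^{-tS} ≥ e^{-t}` with `e^{tS} ≥ 1`. -/
theorem conjS_sub_smul_mem_posOps {D : Op} (h : D ∈ posOps) {t : ℝ} (ht : 0 ≤ t) :
    conjS t D - Real.exp (-t) • D ∈ posOps := by
  have h1 := mul_mem_posOps (mul_mem_posOps (expS_neg_sub_mem_posOps ht) h)
    (majorises_expS ht).mem_posOps
  have h2 := smul_mem_posOps (mul_mem_posOps h (expS_sub_one_mem_posOps ht))
    (Real.exp_nonneg (-t))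
  convert add_mem_posOps h1 h2 using 1
  simp only [L2Volterra.conjS, sub_mul, mul_sub, smul_mul_assoc, one_mul, mul_one, smul_sub]
  abel

theorem hasDerivAt_expS (t : ℝ) : HasDerivAt expS (expS t * S) t :=
  hasDerivAt_exp_smul_const S t

theorem hasDerivAt_conjS (A : Op) (t : ℝ) :
    HasDerivAt (fun s => conjS s A) (-comm S (conjS t A)) t := by
  have h1 : HasDerivAt (fun s => expS (-s)) (-(expS (-t) * S)) t := by
    have := (hasDerivAt_expS (-t)).scomp t (hasDerivAt_neg t)
    rw [neg_smul, one_smul] at this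
    exact this
  have h3 := (h1.mul_const A).mul (hasDerivAt_expS t)
  refine h3.congr_deriv ?_
  have h2 : S * expS (-t) = expS (-t) * S := commute_expS (Commute.refl S) _
  rw [← h2]
  simp only [comm, conjS, neg_mul, mul_assoc]
  abel

theorem continuous_conjS (A : Op) : Continuous fun s => conjS s A :=
  continuous_iff_continuousAt.2 fun t => (hasDerivAt_conjS A t).continuousAt

theorem continuous_comm_conjS (A : Op) : Continuous fun s => comm S (conjS s A) :=
  (continuous_const.mul (continuous_conjS A)).sub ((continuous_conjS A).mul continuous_const)

theorem integral_comm_conjS (A : Op) (x y : ℝ) :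
    ∫ s in x..y, comm S (conjS s A) = conjS x A - conjS y A := by
  have h := intervalIntegral.integral_eq_sub_of_hasDerivAt
    (f := fun s => -conjS s A) (f' := fun s => comm S (conjS s A)) (a := x) (b := y)
    (fun s _ => (hasDerivAt_conjS A s).neg.congr_deriv (neg_neg _))
    ((continuous_comm_conjS A).intervalIntegrable _ _)
  rw [h]
  abel

theorem comm_integral_conjS (A : Op) (x y : ℝ) :
    comm S (∫ s in x..y, conjS s A) = conjS x A - conjS y A := by
  rw [← integral_comm_conjS]
  exact (ContinuousLinearMap.intervalIntegral_comp_comm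
    (ContinuousLinearMap.mul ℝ Op S - (ContinuousLinearMap.mul ℝ Op).flip S)
    ((continuous_conjS A).intervalIntegrable x y)).symm

/-! ### The Volterra algebra and its closure under strong limits. -/

theorem commute_chi_S (a : ℝ) : Commute (chi a) S := by
  refine ContinuousLinearMap.ext fun f => Lp.ext ?_
  change chi a (S f) =ᵐ[mu] S (chi a f)
  filter_upwards [chi_apply_ae a f, chi_apply_ae a (S f), S_apply_ae f, S_apply_ae (chi a f)]
    with x h1 h2 h3 h4
  rw [h2, h3, h4, h1]
  ring

theorem chi_mul_chi (a : ℝ) : chi a * chi a = chi a := by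
  refine ContinuousLinearMap.ext fun f => Lp.ext ?_
  change chi a (chi a f) =ᵐ[mu] chi a f
  filter_upwards [chi_apply_ae a f, chi_apply_ae a (chi a f)] with x h1 h2
  rw [h2, h1]
  by_cases hx : x ∈ Set.Icc a 1 <;> simp [hx]

theorem mul_mem_volterraAlg {A B : Op} (hA : A ∈ volterraAlg) (hB : B ∈ volterraAlg) :
    A * B ∈ volterraAlg := by
  intro a ha
  calc A * B * chi a = A * chi a * B * chi a := by rw [mul_assoc, hB a ha]; simp only [mul_assoc]
    _ = chi a * A * (chi a * B * chi a) := by rw [hA a ha]; simp only [mul_assoc]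
    _ = chi a * (A * B) * chi a := by rw [← hB a ha]; simp only [mul_assoc]

theorem expS_mem_volterraAlg (t : ℝ) : expS t ∈ volterraAlg := by
  intro a _
  rw [(commute_expS (commute_chi_S a) t).eq, mul_assoc, chi_mul_chi]

theorem conjS_mem_volterraAlg {A : Op} (hA : A ∈ volterraAlg) (t : ℝ) :
    conjS t A ∈ volterraAlg :=
  mul_mem_volterraAlg (mul_mem_volterraAlg (expS_mem_volterraAlg _) hA) (expS_mem_volterraAlg _)

theorem zero_mem_volterraAlg : (0 : Op) ∈ volterraAlg := fun a _ => by simp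

theorem add_mem_volterraAlg {A B : Op} (hA : A ∈ volterraAlg) (hB : B ∈ volterraAlg) :
    A + B ∈ volterraAlg := fun a ha => by
  rw [add_mul, mul_add, add_mul, hA a ha, hB a ha]

theorem smul_mem_volterraAlg {A : Op} (hA : A ∈ volterraAlg) (c : ℝ) :
    c • A ∈ volterraAlg := fun a ha => by
  rw [smul_mul_assoc, mul_smul_comm, smul_mul_assoc, hA a ha]

theorem mem_volterraAlg_of_tendsto {ι : Type*} {l : Filter ι} [l.NeBot] {a : ι → Op} {A : Op}
    (ha : ∀ f, Tendsto (fun i => a i f) l (𝓝 (A f))) (h : ∀ i, a i ∈ volterraAlg) :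
    A ∈ volterraAlg := by
  intro c hc
  refine ContinuousLinearMap.ext fun f => tendsto_nhds_unique (ha (chi c f)) ?_
  have := ((chi c).continuous.tendsto _).comp (ha (chi c f))
  refine this.congr fun i => ?_
  exact (DFunLike.congr_fun (h i c hc) f).symm

theorem isClosed_volterraAlg : IsClosed volterraAlg := by
  refine isClosed_of_closure_subset fun A hA => ?_
  obtain ⟨u, hu, hl⟩ := mem_closure_iff_seq_limit.1 hA
  exact mem_volterraAlg_of_tendsto (tendsto_apply hl) hu

theorem integral_conjS_mem_volterraAlg {A : Op} (hA : A ∈ volterraAlg) {x y : ℝ} (hxy : x ≤ y) :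
    ∫ s in x..y, conjS s A ∈ volterraAlg :=
  integral_mem_of_cone
    (fun _ hp _ hq _ _ _ _ _ =>
      add_mem_volterraAlg (smul_mem_volterraAlg hp _) (smul_mem_volterraAlg hq _))
    isClosed_volterraAlg zero_mem_volterraAlg (fun c _ _ hx => smul_mem_volterraAlg hx c)
    (continuous_conjS A) hxy fun s _ => conjS_mem_volterraAlg hA s

/-! ### Solving `[S,K] = A`. -/

/-- A decreasing sequence of nonnegative functions in `L₂(0,1)` is Cauchy. -/
theorem cauchySeq_of_decreasing {u : ℕ → H} (h0 : ∀ n, u n ∈ posCone)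
    (hd : ∀ n m, n ≤ m → u n - u m ∈ posCone) : CauchySeq u := by
  have hanti : Antitone fun n => ‖u n‖ ^ 2 := fun n m hnm =>
    pow_le_pow_left₀ (norm_nonneg _) (norm_le_of_sub_mem (h0 m) (hd n m hnm)) 2
  have hlim := tendsto_atTop_ciInf hanti ⟨0, by rintro _ ⟨n, rfl⟩; positivity⟩
  refine Metric.cauchySeq_iff'.2 fun ε hε => ?_
  obtain ⟨N, hN⟩ := Metric.cauchySeq_iff'.1 hlim.cauchySeq (ε ^ 2) (by positivity)
  refine ⟨N, fun n hn => ?_⟩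
  have h1 := hN n hn
  rw [dist_comm, Real.dist_eq] at h1
  have h2 := norm_sub_sq_le (h0 n) (hd N n hn)
  rw [dist_comm, dist_eq_norm]
  exact lt_of_pow_lt_pow_left₀ 2 hε.le (h2.trans_lt ((le_abs_self _).trans_lt h1))

theorem majorises_integral_conjS {B A : Op} (h : Majorises (comm S B) A) {x y : ℝ} (hx : 0 ≤ x)
    (hxy : x ≤ y) : Majorises (conjS x B - conjS y B) (∫ s in x..y, conjS s A) := by
  rw [← integral_comm_conjS]
  refine majorises_integral (continuous_comm_conjS B) (continuous_conjS A) hxy fun s hs => ?_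
  rw [comm_conjS]
  exact h.conjS (hx.trans hs.1)

/-- On `[x, x+1]` the integrand `[S, conjS s B]` is at least `e^{-1} [S, conjS x B]`; integrate.
Thus increments of the flow control its derivative. -/
theorem conjS_sub_conjS_succ_sub_mem_posOps {B : Op} (h : comm S B ∈ posOps) {x : ℝ}
    (hx : 0 ≤ x) :
    conjS x B - conjS (x + 1) B - Real.exp (-1) • comm S (conjS x B) ∈ posOps := by
  have hD : comm S (conjS x B) ∈ posOps := by
    rw [comm_conjS]
    exact ((majorises_zero_iff.2 h).conjS hx).mem_posOps
  have hle : x ≤ x + 1 := by linarith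
  have key := majorises_integral
    (b := fun s => comm S (conjS s B) - Real.exp (-1) • comm S (conjS x B)) (a := fun _ => 0)
    ((continuous_comm_conjS B).sub continuous_const) continuous_const hle (fun s hs => by
      have hs0 : 0 ≤ s - x := sub_nonneg.2 hs.1
      have h1 := conjS_sub_smul_mem_posOps hD hs0
      rw [← comm_conjS, ← conjS_add, sub_add_cancel] at h1
      have h2 : 0 ≤ Real.exp (-(s - x)) - Real.exp (-1) :=
        sub_nonneg.2 (Real.exp_le_exp.2 (by linarith [hs.2]))
      have h3 := add_mem_posOps h1 (smul_mem_posOps hD h2)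
      rw [sub_smul, sub_add_sub_cancel] at h3
      exact majorises_zero_iff.2 h3)
  rw [intervalIntegral.integral_sub ((continuous_comm_conjS B).intervalIntegrable _ _)
    (continuous_const.intervalIntegrable _ _), integral_comm_conjS,
    intervalIntegral.integral_const, add_sub_cancel_left, one_smul] at key
  exact key.mem_posOps

/-- If `B ≥ 0` and `[S,B]` majorises `A`, then `[S,K] = A` has a solution majorised by `B`. -/
theorem exists_comm_eq {B A : Op} (hB : B ∈ posOps) (h : Majorises (comm S B) A)
    (hA : A ∈ volterraAlg) :
    ∃ K : Op, comm S K = A ∧ Majorises B K ∧ K ∈ volterraAlg := by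
  set k : ℕ → Op := fun n => ∫ s in (0 : ℝ)..n, conjS s A with hk
  have hBt : ∀ t : ℝ, 0 ≤ t → conjS t B ∈ posOps := fun t ht =>
    ((majorises_zero_iff.2 hB).conjS ht).mem_posOps
  have hdecr : ∀ f, CauchySeq fun n : ℕ => conjS n B (absH f) := fun f =>
    cauchySeq_of_decreasing (fun n => hBt n n.cast_nonneg _ (absH_mem_posCone f)) fun n m hnm =>
      (majorises_integral_conjS h n.cast_nonneg (Nat.cast_le.2 hnm)).mem_posOps _
        (absH_mem_posCone f)
  have hkdiff : ∀ n m : ℕ, k m - k n = ∫ s in (n : ℝ)..m, conjS s A := fun n m =>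
    intervalIntegral.integral_interval_sub_left ((continuous_conjS A).intervalIntegrable _ _)
      ((continuous_conjS A).intervalIntegrable _ _)
  have hkcauchy : ∀ f, CauchySeq fun n => k n f := by
    intro f
    refine Metric.cauchySeq_iff'.2 fun ε hε => ?_
    obtain ⟨N, hN⟩ := Metric.cauchySeq_iff'.1 (hdecr f) ε hε
    refine ⟨N, fun n hn => lt_of_le_of_lt ?_ (hN n hn)⟩
    have := (majorises_integral_conjS h N.cast_nonneg (Nat.cast_le.2 hn)).norm_apply_le f
    rw [← hkdiff] at this
    rw [dist_eq_norm, dist_comm, dist_eq_norm]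
    exact this
  -- Convergence is only strong; boundedness of the limit comes from Banach–Steinhaus.
  choose K₀ hK₀ using fun f => cauchySeq_tendsto_of_complete (hkcauchy f)
  let K : Op := continuousLinearMapOfTendsto k (tendsto_pi_nhds.2 hK₀)
  have hK : ∀ f, Tendsto (fun n => k n f) atTop (𝓝 (K f)) := hK₀
  -- The boundary term at infinity vanishes: `conjS n A` is majorised by `[S, conjS n B]`, hence by
  -- `e` times a unit increment of the convergent flow of `B`.
  have hAn : ∀ f, Tendsto (fun n : ℕ => conjS n A f) atTop (𝓝 0) := by
    intro f
    have h1 : Tendsto (fun n : ℕ => Real.exp 1 *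
        ‖conjS n B (absH f) - conjS (n + 1 : ℕ) B (absH f)‖) atTop (𝓝 0) := by
      obtain ⟨w, hw⟩ := cauchySeq_tendsto_of_complete (hdecr f)
      have := ((hw.sub (hw.comp (tendsto_add_atTop_nat 1))).norm).const_mul (Real.exp 1)
      simpa using this
    refine squeeze_zero_norm (fun n => ?_) h1
    have hmaj : Majorises (comm S (conjS n B)) (conjS n A) := by
      rw [comm_conjS]
      exact h.conjS n.cast_nonneg
    have h2 := smul_mem_posCone (hmaj.mem_posOps _ (absH_mem_posCone f)) (Real.exp_nonneg (-1))
    have h3 := conjS_sub_conjS_succ_sub_mem_posOps h.mem_posOps (n.cast_nonneg (α := ℝ)) _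
      (absH_mem_posCone f)
    have h4 := norm_le_of_sub_mem h2 h3
    rw [norm_smul, Real.norm_eq_abs, abs_of_pos (Real.exp_pos _), Real.exp_neg,
      inv_mul_le_iff₀ (Real.exp_pos 1)] at h4
    refine (hmaj.norm_apply_le f).trans (h4.trans (le_of_eq ?_))
    rw [Nat.cast_succ]
    rfl
  refine ⟨K, ContinuousLinearMap.ext fun f => ?_, ?_, ?_⟩
  · have h1 : Tendsto (fun n => comm S (k n) f) atTop (𝓝 (comm S K f)) :=
      ((S.continuous.tendsto _).comp (hK f)).sub (hK (S f))
    have h2 : Tendsto (fun n => comm S (k n) f) atTop (𝓝 (A f - 0)) := by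
      refine (tendsto_const_nhds.sub (hAn f)).congr fun n => ?_
      simp only [hk]
      rw [comm_integral_conjS, conjS_zero]
      rfl
    rw [sub_zero] at h2
    exact tendsto_nhds_unique h1 h2
  · refine majorises_of_tendsto (b := fun _ => B) (fun f => tendsto_const_nhds) hK fun n => ?_
    refine (majorises_integral_conjS h le_rfl n.cast_nonneg).mono ?_
    rw [conjS_zero, sub_sub_cancel]
    exact hBt n n.cast_nonneg
  · exact mem_volterraAlg_of_tendsto hK fun n =>
      integral_conjS_mem_volterraAlg hA n.cast_nonneg

/-! ### The Neumann series and spectral radii. -/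

/-- Leibniz rule: `[S, W^{n+1}] = [S,W] W^n + W [S, W^n]`, with induction on the last term. -/
theorem comm_pow_mem_posOps {W : Op} (hW : W ∈ posOps) (h : comm S W ∈ posOps) (n : ℕ) :
    comm S (W ^ (n + 1)) - comm S W * W ^ n ∈ posOps ∧ comm S (W ^ n) ∈ posOps := by
  have hpow : ∀ n, W ^ n ∈ posOps := fun n => by
    induction n with
    | zero => exact majorises_one.mem_posOps
    | succ n ih => rw [pow_succ]; exact mul_mem_posOps ih hW
  have hrec : ∀ n, comm S (W ^ (n + 1)) - comm S W * W ^ n = W * comm S (W ^ n) := fun n => by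
    simp only [comm, pow_succ', sub_mul, mul_sub, mul_assoc]
    abel
  have hpos : ∀ n, comm S (W ^ n) ∈ posOps := fun n => by
    induction n with
    | zero => simpa [comm] using majorises_zero.mem_posOps
    | succ n ih =>
      have := add_mem_posOps (mul_mem_posOps hW ih) (mul_mem_posOps h (hpow n))
      rwa [← hrec, sub_add_cancel] at this
  exact ⟨hrec n ▸ mul_mem_posOps hW (hpos n), hpos n⟩

theorem summable_norm_pow_of_spectralRadius_lt_one {W : Op} (h : spectralRadius ℂ W < 1) :
    Summable fun n => ‖W ^ n‖ := by
  obtain ⟨r, hr, hr1⟩ := ENNReal.lt_iff_exists_nnreal_btwn.1 h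
  have hev := (spectrum.pow_nnnorm_pow_one_div_tendsto_nhds_spectralRadius W).eventually_lt_const hr
  refine Summable.of_norm_bounded_eventually_nat (g := fun n => (r : ℝ) ^ n)
    (summable_geometric_of_lt_one r.2 (by exact_mod_cast hr1)) ?_
  filter_upwards [hev, eventually_gt_atTop 0] with n hn hn0
  have h1 : (‖W ^ n‖₊ : ℝ≥0∞) ≤ (r : ℝ≥0∞) ^ n := by
    have := ENNReal.rpow_le_rpow hn.le (z := n) n.cast_nonneg
    rwa [← ENNReal.rpow_mul, one_div_mul_cancel (by exact_mod_cast hn0.ne'), ENNReal.rpow_one,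
      ENNReal.rpow_natCast] at this
  rw [norm_norm]
  exact_mod_cast h1

/-- Powers of `B` majorise powers of `A`, so Gelfand's formula compares the radii. -/
theorem Majorises.spectralRadius_le {B A : Op} (h : Majorises B A) :
    spectralRadius ℂ A ≤ spectralRadius ℂ B := by
  refine le_of_tendsto_of_tendsto
    (spectrum.pow_nnnorm_pow_one_div_tendsto_nhds_spectralRadius A)
    (spectrum.pow_nnnorm_pow_one_div_tendsto_nhds_spectralRadius B)
    (Eventually.of_forall fun n => ?_)
  exact ENNReal.rpow_le_rpow (ENNReal.coe_le_coe.2 (h.pow n).norm_le) (by positivity)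

/-- Here `1 + M = (1 - W)⁻¹` and `z - M = (z - (1+z)W)(1 + M)`. For `|z| ≥ 1` the first factor is
invertible, as `|z/(1+z)| ≥ 1/2`; at `z = -1` it is just `-1`. -/
theorem spectralRadius_lt_one_of_mul_one_sub_eq {W M : Op} (h : spectralRadius ℂ W < 1 / 2)
    (h1 : M * (1 - W) = W) (h2 : (1 - W) * M = W) : spectralRadius ℂ M < 1 := by
  rcases (spectrum ℂ M).eq_empty_or_nonempty with he | hne
  · simp [spectralRadius, he]
  rw [← ENNReal.coe_one]
  refine spectrum.spectralRadius_lt_of_forall_lt_of_nonempty hne fun z hz => ?_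
  by_contra hlt
  have hz1 : 1 ≤ ‖z‖ := by exact_mod_cast not_lt.1 hlt
  have hu : IsUnit (1 + M) := by
    refine ⟨⟨1 + M, 1 - W, ?_, ?_⟩, rfl⟩
    · rw [add_mul, one_mul, h1, sub_add_cancel]
    · rw [mul_add, mul_one, h2, sub_add_cancel]
  have hX : IsUnit (z • (1 : Op) - (1 + z) • W) := by
    rcases eq_or_ne (1 + z) 0 with h0 | h0
    · rw [h0, zero_smul, sub_zero, eq_neg_of_add_eq_zero_right h0, neg_smul, one_smul]
      exact isUnit_one.neg
    have hw : spectralRadius ℂ W < ‖z / (1 + z)‖₊ := by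
      refine h.trans_le ?_
      have h3 : (1 / 2 : ℝ) ≤ ‖z / (1 + z)‖ := by
        rw [norm_div, le_div_iff₀ (norm_pos_iff.2 h0)]
        have := norm_add_le (1 : ℂ) z
        rw [norm_one] at this
        linarith
      have h4 : (1 / 2 : NNReal) ≤ ‖z / (1 + z)‖₊ := by exact_mod_cast h3
      calc (1 / 2 : ℝ≥0∞) = ((1 / 2 : NNReal) : ℝ≥0∞) := by simp
        _ ≤ _ := ENNReal.coe_le_coe.2 h4
    have h5 := spectrum.mem_resolventSet_iff.1 (spectrum.mem_resolventSet_of_spectralRadius_lt hw)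
    have h6 := h5.smul (Units.mk0 _ h0)
    rw [Units.smul_mk0, smul_sub, Algebra.algebraMap_eq_smul_one, smul_smul,
      mul_div_cancel₀ _ h0] at h6
    exact h6
  refine spectrum.mem_iff.1 hz ?_
  have h7 := hX.mul hu
  convert h7 using 1
  have h8 : W * M = M - W := by
    rw [sub_mul, one_mul] at h2
    exact eq_sub_of_add_eq (by rw [add_comm]; exact (sub_eq_iff_eq_add.1 h2).symm)
  rw [Algebra.algebraMap_eq_smul_one]
  simp only [sub_mul, add_mul, mul_add, mul_one, smul_mul_assoc, one_mul, h8, add_smul, one_smul, smul_sub]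
  abel

/-- The terms of the Neumann-type series solving `[S,K] + VK + V = 0`. -/
theorem exists_neumann_terms {V W : Op} (hV : V ∈ volterraAlg) (hW : W ∈ posOps)
    (h : Majorises (comm S W) V) :
    ∃ k : ℕ → Op, (∀ n, Majorises (W ^ n) (k n)) ∧ (∀ n, k n ∈ volterraAlg) ∧ k 0 = 1 ∧
      ∀ n, comm S (k (n + 1)) = -(V * k n) := by
  have step : ∀ (n : ℕ) (X : {X : Op // Majorises (W ^ n) X ∧ X ∈ volterraAlg}),
      ∃ Y : {Y : Op // Majorises (W ^ (n + 1)) Y ∧ Y ∈ volterraAlg},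
        comm S Y.1 = -(V * X.1) := by
    rintro n ⟨X, hX, hXV⟩
    have hmaj : Majorises (comm S (W ^ (n + 1))) (-(V * X)) :=
      (h.mul hX).neg.mono (comm_pow_mem_posOps hW h.mem_posOps n).1
    have hneg : -(V * X) ∈ volterraAlg := by
      simpa using smul_mem_volterraAlg (mul_mem_volterraAlg hV hXV) (-1)
    obtain ⟨Y, h1, h2, h3⟩ :=
      exists_comm_eq ((majorises_zero_iff.2 hW).pow (n + 1)).mem_posOps hmaj hneg
    exact ⟨⟨Y, h2, h3⟩, h1⟩
  choose F hF using step
  have h0 : Majorises (W ^ 0) 1 ∧ (1 : Op) ∈ volterraAlg := by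
    refine ⟨by simpa using majorises_one, ?_⟩
    simpa [expS_zero] using expS_mem_volterraAlg 0
  let k : ∀ n : ℕ, {X : Op // Majorises (W ^ n) X ∧ X ∈ volterraAlg} := fun n =>
    Nat.rec ⟨1, h0⟩ F n
  exact ⟨fun n => (k n).1, fun n => (k n).2.1, fun n => (k n).2.2, rfl, fun n => hF n (k n)⟩

theorem hasSum_mem_volterraAlg {a : ℕ → Op} {A : Op} (ha : HasSum a A)
    (h : ∀ n, a n ∈ volterraAlg) : A ∈ volterraAlg := by
  refine mem_volterraAlg_of_tendsto (tendsto_apply ha.tendsto_sum_nat) fun n => ?_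
  induction n with
  | zero => simpa using zero_mem_volterraAlg
  | succ n ih => rw [Finset.sum_range_succ]; exact add_mem_volterraAlg ih (h n)

end L2Volterra

end

theorem corollary3p4 (V W : L2Volterra.Op)
    (hV : V ∈ L2Volterra.volterraAlg)
    (hW : W ∈ L2Volterra.volterraPos)
    (hWV : L2Volterra.Majorises (L2Volterra.comm L2Volterra.S W) V)
    (hspr : spectralRadius ℂ W < 1 / 2) :
    ∃ K : L2Volterra.Op,
      K ∈ L2Volterra.majorisedOps ∩ L2Volterra.volterraAlg ∧
      L2Volterra.comm L2Volterra.S K + V * K + V = 0 ∧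
      spectralRadius ℂ K < 1 := by
  open L2Volterra in
  obtain ⟨k, hk, hkV, hk0, hkS⟩ := exists_neumann_terms hV hW.2 hWV
  have hlt : spectralRadius ℂ W < 1 := hspr.trans_le (by simp)
  have hsum : Summable fun n => ‖W ^ n‖ := summable_norm_pow_of_spectralRadius_lt_one hlt
  have hsW : Summable fun n => W ^ n := hsum.of_norm
  have hsk : Summable k := Summable.of_norm_bounded hsum fun n => (hk n).norm_le
  -- Drop the term `n = 0`, which is `1` in both series.
  have hM := ((hasSum_nat_add_iff' 1).2 hsW.hasSum)
  have hK := ((hasSum_nat_add_iff' 1).2 hsk.hasSum)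
  simp only [Finset.sum_range_one, pow_zero, hk0] at hM hK
  set M : Op := ∑' n, W ^ n - 1 with hMdef
  set K : Op := ∑' n, k n - 1 with hKdef
  have hMK : Majorises M K := majorises_hasSum hM hK fun n => hk (n + 1)
  have hM1 : M * (1 - W) = W := by
    rw [hMdef, sub_mul, hsW.tsum_pow_mul_one_sub, one_mul, sub_sub_cancel]
  have hM2 : (1 - W) * M = W := by
    rw [hMdef, mul_sub, hsW.one_sub_mul_tsum_pow, mul_one, sub_sub_cancel]
  refine ⟨K, ⟨⟨M, hMK.mem_majorants⟩, hasSum_mem_volterraAlg hK fun n => hkV (n + 1)⟩, ?_,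
    hMK.spectralRadius_le.trans_lt (spectralRadius_lt_one_of_mul_one_sub_eq hspr hM1 hM2)⟩
  have h1 : HasSum (fun n => comm S (k (n + 1))) (comm S K) := (hK.mul_left S).sub (hK.mul_right S)
  simp only [hkS] at h1
  -- The index shift restores the missing term: `∑_{n≥0} k_n = K + 1`.
  have h2 : HasSum (fun n => -(V * k n)) (-(V * (K + 1))) := by
    rw [hKdef, sub_add_cancel]
    exact (hsk.hasSum.mul_left V).neg
  rw [h1.unique h2, mul_add, mul_one]
  abel
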